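/- Let $\operatorname{sinc}(x)=\frac{\sin(\pi x)}{\pi x}$ for $x\neq0$ and $\operatorname{sinc}(0)=1$. Let $PW_\pi$ be the closed subspace of (complex-valued) functions $f\in L^2(\mathbb R)$ whose Fourier transform $\mathcal F(f)(\xi)=\int_{\mathbb R} f(t)e^{-i\xi t}\,dt$ is supported in $[-\pi,\pi]$, with the inner product $\langle f,g\rangle=\int_{\mathbb R} f(t)\overline{g(t)}\,dt$. Let $\{\lambda_n\}_{n\in\mathbb Z}$ be a sequence of real numbers and $L<\frac14$ a real number such that $|\lambda_n-n|\le L$ for all $n\in\mathbb Z$. Then there is exactly one system $\{x_n'\}_{n\in\mathbb Z}$ in $PW_\pi$ that is biorthogonal to $\{\operatorname{sinc}(\cdot-\lambda_n)\}_{n\in\mathbb Z}$, that is, $\langle \operatorname{sinc}(\cdot-\lambda_k),x_n'\rangle=\delta_{k,n}$ for all $k,n\in\mathbb Z$; and if $f\in PW_\pi$ is continuous, then $$f(t)=\sum_{n\in\mathbb Z}\langle f,x_n'\rangle\operatorname{sinc}(t-\lambda_n),$$ where the series converges unconditionally to $f$ in $L^2(\mathbb R)$ and also converges unconditionally to $f(t)$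 at every point $t\in\mathbb R$. -/

import Mathlib

open MeasureTheory FourierTransform

noncomputable section

/-- The Hilbert space `L²(ℝ)` of complex-valued functions. -/
abbrev L2R : Type := Lp (α := ℝ) ℂ 2

/-- The normalized sinc function: `sin (π x) / (π x)` for `x ≠ 0`, and `1` for `x = 0`. -/
def nsinc (x : ℝ) : ℝ := Real.sinc (Real.pi * x)

theorem nsinc_zero : nsinc 0 = 1 := by simp [nsinc]

theorem nsinc_of_ne_zero {x : ℝ} (hx : x ≠ 0) :
    nsinc x = Real.sin (Real.pi * x) / (Real.pi * x) :=
  Real.sinc_of_ne_zero (mul_ne_zero Real.pi_ne_zero hx)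

theorem continuous_nsinc : Continuous nsinc :=
  Real.continuous_sinc.comp (continuous_const.mul continuous_id)

theorem nsinc_sq_le (x : ℝ) : nsinc x ^ 2 ≤ 2 * (1 + x ^ 2)⁻¹ := by
  have hp : 0 < 1 + x ^ 2 := by positivity
  rw [← div_eq_mul_inv, le_div_iff₀ hp]
  have h1 : nsinc x ^ 2 ≤ 1 := by
    rw [sq_le_one_iff_abs_le_one]
    exact Real.abs_sinc_le_one _
  have h2 : (nsinc x * x) ^ 2 ≤ 1 := by
    by_cases hx : x = 0
    · simp [hx]
    · have h3 : nsinc x * (Real.pi * x) = Real.sin (Real.pi * x) := by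
        rw [nsinc_of_ne_zero hx]
        have := Real.pi_ne_zero
        field_simp
      have h4 : (nsinc x * x) ^ 2 * Real.pi ^ 2 ≤ 1 := by
        calc (nsinc x * x) ^ 2 * Real.pi ^ 2 = Real.sin (Real.pi * x) ^ 2 := by rw [← h3]; ring
          _ ≤ 1 := Real.sin_sq_le_one _
      have h5 : 1 ≤ Real.pi ^ 2 := by nlinarith [Real.pi_gt_three]
      nlinarith [sq_nonneg (nsinc x * x)]
  nlinarith

/-- Every translate `t ↦ sinc (t - μ)`, `μ` real, is square integrable. -/
theorem memLp_nsinc_sub (μ : ℝ) :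
    MemLp (fun t : ℝ => ((nsinc (t - μ) : ℝ) : ℂ)) 2 volume := by
  have hc : Continuous (fun t : ℝ => ((nsinc (t - μ) : ℝ) : ℂ)) :=
    Complex.continuous_ofReal.comp (continuous_nsinc.comp (continuous_id.sub continuous_const))
  rw [memLp_two_iff_integrable_sq_norm hc.aestronglyMeasurable]
  have hi : Integrable (fun t : ℝ => 2 * (1 + (t - μ) ^ 2)⁻¹) :=
    (integrable_inv_one_add_sq.comp_sub_right μ).const_mul 2
  refine hi.mono' (hc.norm.pow 2).aestronglyMeasurable (Filter.Eventually.of_forall fun t => ?_)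
  have h := nsinc_sq_le (t - μ)
  simpa using h

/-- The function `t ↦ sinc (t - μ)` as an element of `L²(ℝ)`. -/
def sincShift (μ : ℝ) : L2R := (memLp_nsinc_sub μ).toLp _

/-- The Paley-Wiener space `PW_σ`: the functions in `L²(ℝ)` whose Fourier transform
`∫ f(t) e^{-iξt} dt` is supported in `[-σ, σ]`, as a subspace of `L²(ℝ)`. Mathlib's Fourier
transform is `∫ f(t) e^{-2πiwt} dt`, so that the angular frequency is `ξ = 2πw`. -/
def paleyWiener (σ : ℝ) : Submodule ℂ L2R where
  carrier := {f | ∀ᵐ w : ℝ, 2 * Real.pi * w ∉ Set.Icc (-σ) σ → (𝓕 f : L2R) w = 0}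
  zero_mem' := by
    have h0 : (𝓕 (0 : L2R) : L2R) = 0 := (Lp.fourierTransformₗᵢ ℝ ℂ).map_zero
    simp only [Set.mem_ofPred_eq, h0]
    filter_upwards [Lp.coeFn_zero ℂ 2 (volume : Measure ℝ)] with w hw _
    rw [hw, Pi.zero_apply]
  add_mem' := by
    intro f g hf hg
    have h0 : (𝓕 (f + g) : L2R) = 𝓕 f + 𝓕 g := (Lp.fourierTransformₗᵢ ℝ ℂ).map_add f g
    simp only [Set.mem_ofPred_eq, h0] at hf hg ⊢
    filter_upwards [hf, hg, Lp.coeFn_add (𝓕 f : L2R) (𝓕 g)] with w h1 h2 h3 hw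
    rw [h3, Pi.add_apply, h1 hw, h2 hw, add_zero]
  smul_mem' := by
    intro c f hf
    have h0 : (𝓕 (c • f) : L2R) = c • 𝓕 f := (Lp.fourierTransformₗᵢ ℝ ℂ).map_smul c f
    simp only [Set.mem_ofPred_eq, h0] at hf ⊢
    filter_upwards [hf, Lp.coeFn_smul c (𝓕 f : L2R)] with w h1 h2 hw
    rw [h2, Pi.smul_apply, h1 hw, smul_zero]

/-- `x'` is biorthogonal to `x`: `⟨x k, x' n⟩ = δ_{k,n}`. Here `⟨f, g⟩ = ∫ f conj(g)` is linear
in its first argument; Mathlib's `inner ℂ` is linear in its second one, hence the order. -/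
def IsBiorthogonal {H : Type*} [NormedAddCommGroup H] [InnerProductSpace ℂ H]
    (x x' : ℤ → H) : Prop :=
  ∀ k n : ℤ, inner ℂ (x' n) (x k) = if k = n then (1 : ℂ) else 0

end

/-! On the Fourier side the translates `sinc (· - μ)` become characters on the band `[-1/2, 1/2]`,
so for every real shift `s` the system `sinc (· - n - s)` is an orthonormal basis of the
Paley-Wiener space. Pairing with `sinc (· - t)` evaluates a continuous element at `t`.

The core is Kadec's argument. With `δ = lam n - n` and angular frequency `x`, write `1 - exp (-iδx)
= (1 - cos δx) + i sin δx`. The even part is expanded in `exp (ikx)`, the odd part in `exp (i(k +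
1/2)x)`; the half shift makes the antiperiodic extension of `sin δx` continuous, so both families of
coefficients are absolutely summable. For fixed `k` the shifted sincs indexed by `n` are
orthonormal, so each `k` contributes an operator of norm at most the supremum of its coefficient. By
the cotangent and tangent series these suprema add up to `1 - cos πL + sin πL`, which is less than
`1` because `πL < π/4`. A Neumann series then gives an invertible `T` taking the basis `b n` to
`sinc (· - lam n)`.

The biorthogonal system is forced to be `(T⁻¹)* (b n)`, and the expansion is the image under `T` of
the basis expansion of `T⁻¹ f`. `HasSum` expresses unconditional convergence throughout. -/

open Set Filter Topology
open scoped ContDiff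

noncomputable section

/-! ### Fourier transforms of the sinc translates -/

/-- The `L²` inverse Fourier transform agrees with the integral on `L¹ ∩ L²`. -/
theorem fourierInv_toLp_ae_eq {g : ℝ → ℂ} (hg2 : MemLp g 2 volume) (hg1 : Integrable g) :
    ((𝓕⁻ (hg2.toLp g) : L2R) : ℝ → ℂ) =ᵐ[volume] 𝓕⁻ g := by
  have hcont : Continuous (𝓕⁻ g) :=
    VectorFourier.fourierIntegral_continuous Real.continuous_fourierChar
      (by exact (continuous_inner (𝕜 := ℝ) (E := ℝ)).neg) hg1
  refine ae_eq_of_integral_contDiff_smul_eq ((Lp.memLp _).locallyIntegrable (by norm_num))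
    hcont.locallyIntegrable fun φ hφ hφc => ?_
  have h₁ : HasCompactSupport (Complex.ofRealCLM ∘ φ) := hφc.comp_left rfl
  have h₂ : ContDiff ℝ ∞ (Complex.ofRealCLM ∘ φ) := by fun_prop
  set S : SchwartzMap ℝ ℂ := h₁.toSchwartzMap h₂ with hS
  have hSφ : ∀ x, S x = (φ x : ℂ) := fun x => rfl
  -- As a tempered distribution, the `L²` transform is defined by moving the transform onto the test
  -- function.
  have e1 : ∫ x, φ x • ((𝓕⁻ (hg2.toLp g) : L2R) : ℝ → ℂ) x = ∫ x, (𝓕⁻ S : SchwartzMap ℝ ℂ) x • g x := by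
    have h := congrArg (fun T : TemperedDistribution ℝ ℂ => T S)
      (Lp.fourierInv_toTemperedDistribution_eq (hg2.toLp g))
    simp only [TemperedDistribution.fourierInv_apply, Lp.toTemperedDistribution_apply] at h
    calc _ = ∫ x, S x • ((𝓕⁻ (hg2.toLp g) : L2R) : ℝ → ℂ) x := by
            simp [hSφ]
      _ = _ := h.symm
      _ = _ := by
        refine integral_congr_ae ?_
        filter_upwards [hg2.coeFn_toLp] with x hx
        rw [hx]
  rw [e1]
  -- Fubini moves the transform from `S` back onto the integrable function `g`.
  have h := VectorFourier.integral_fourierIntegral_smul_eq_flip (L := -innerₗ ℝ) (μ := volume)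
    (ν := volume) (f := (S : ℝ → ℂ)) (g := g)
    Real.continuous_fourierChar (by exact (continuous_inner (𝕜 := ℝ) (E := ℝ)).neg) S.integrable hg1
  have hfl : (-innerₗ ℝ : ℝ →ₗ[ℝ] ℝ →ₗ[ℝ] ℝ).flip = -innerₗ ℝ := by
    ext; simp
  rw [hfl] at h
  rw [SchwartzMap.fourierInv_coe]
  calc _ = _ := h
    _ = ∫ x, φ x • 𝓕⁻ g x := by
      simp only [hSφ, Complex.coe_smul]
      rfl

/-- The Fourier transform of `sincShift μ`: a character restricted to `[-1/2, 1/2]`. -/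
def bandExp (μ : ℝ) : ℝ → ℂ :=
  (Icc (-(1 / 2) : ℝ) (1 / 2)).indicator fun w => Complex.exp (-(2 * Real.pi * μ * w : ℝ) * Complex.I)

theorem bandExp_of_mem (μ : ℝ) {w : ℝ} (h : w ∈ Icc (-(1 / 2) : ℝ) (1 / 2)) :
    bandExp μ w = Complex.exp (-(2 * Real.pi * μ * w : ℝ) * Complex.I) :=
  indicator_of_mem h _

theorem bandExp_of_notMem (μ : ℝ) {w : ℝ} (h : w ∉ Icc (-(1 / 2) : ℝ) (1 / 2)) :
    bandExp μ w = 0 :=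
  indicator_of_notMem h _

theorem norm_bandExp_le (μ w : ℝ) : ‖bandExp μ w‖ ≤ 1 := by
  by_cases h : w ∈ Icc (-(1 / 2) : ℝ) (1 / 2)
  · rw [bandExp_of_mem μ h, ← Complex.ofReal_neg, Complex.norm_exp_ofReal_mul_I]
  · rw [bandExp_of_notMem μ h, norm_zero]
    exact zero_le_one

theorem aestronglyMeasurable_bandExp (μ : ℝ) : AEStronglyMeasurable (bandExp μ) volume :=
  (Continuous.aestronglyMeasurable (by fun_prop)).indicator measurableSet_Icc

theorem memLp_bandExp (μ : ℝ) (p : ENNReal) : MemLp (bandExp μ) p volume := by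
  have hc : MemLp (fun _ : ℝ => (1 : ℂ)) p (volume.restrict (Icc (-(1 / 2) : ℝ) (1 / 2))) :=
    memLp_const 1
  rw [← memLp_indicator_iff_restrict measurableSet_Icc] at hc
  refine hc.mono (aestronglyMeasurable_bandExp μ) (Eventually.of_forall fun w => ?_)
  by_cases h : w ∈ Icc (-(1 / 2) : ℝ) (1 / 2)
  · rw [indicator_of_mem h]
    simpa using norm_bandExp_le μ w
  · rw [bandExp_of_notMem μ h, norm_zero]
    exact norm_nonneg _

theorem integrable_bandExp (μ : ℝ) : Integrable (bandExp μ) :=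
  memLp_one_iff_integrable.1 (memLp_bandExp μ 1)

theorem integral_exp_eq_nsinc (x : ℝ) :
    ∫ w in (-(1 / 2) : ℝ)..(1 / 2), Complex.exp ((2 * Real.pi * x * w : ℝ) * Complex.I)
      = (nsinc x : ℂ) := by
  by_cases hx : x = 0
  · simp [hx, nsinc_zero]; norm_num
  have hp : (2 * Real.pi * x) ≠ 0 := by positivity
  have h := intervalIntegral.integral_comp_mul_left (a := -(1 / 2 : ℝ)) (b := 1 / 2)
    (fun t : ℝ => Complex.exp (t * Complex.I)) hp
  rw [h, show 2 * Real.pi * x * -(1 / 2) = -(Real.pi * x) by ring,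
    show 2 * Real.pi * x * (1 / 2) = Real.pi * x by ring, integral_exp_mul_I_eq_sinc, nsinc]
  have : (Real.pi : ℂ) ≠ 0 := by exact_mod_cast Real.pi_ne_zero
  have : (x : ℂ) ≠ 0 := by exact_mod_cast hx
  simp only [Complex.real_smul]
  push_cast
  field_simp

theorem fourierInv_bandExp (μ t : ℝ) : 𝓕⁻ (bandExp μ) t = (nsinc (t - μ) : ℂ) := by
  rw [Real.fourierInv_eq', ← integral_exp_eq_nsinc, intervalIntegral.integral_of_le (by norm_num),
    ← integral_Icc_eq_integral_Ioc, ← integral_indicator measurableSet_Icc]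
  refine integral_congr_ae (Eventually.of_forall fun w => ?_)
  by_cases h : w ∈ Icc (-(1 / 2) : ℝ) (1 / 2)
  · simp only [bandExp_of_mem μ h, indicator_of_mem h, smul_eq_mul]
    rw [← Complex.exp_add]
    congr 1
    simp
    ring
  · simp only [bandExp_of_notMem μ h, indicator_of_notMem h, smul_zero]

theorem fourierInv_toLp_bandExp (μ : ℝ) :
    (𝓕⁻ ((memLp_bandExp μ 2).toLp (bandExp μ)) : L2R) = sincShift μ := by
  refine Lp.ext ?_
  filter_upwards [fourierInv_toLp_ae_eq (memLp_bandExp μ 2) (integrable_bandExp μ),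
    (memLp_nsinc_sub μ).coeFn_toLp] with t h1 h2
  rw [h1, fourierInv_bandExp]
  exact h2.symm

theorem fourier_sincShift (μ : ℝ) :
    (𝓕 (sincShift μ) : L2R) = (memLp_bandExp μ 2).toLp (bandExp μ) := by
  rw [← fourierInv_toLp_bandExp]
  exact FourierTransform.fourier_fourierInv_eq _

/-! ### The Paley-Wiener space: reproducing kernel and sinc bases -/

theorem two_pi_mul_mem_Icc_iff (w : ℝ) :
    2 * Real.pi * w ∈ Icc (-Real.pi) Real.pi ↔ w ∈ Icc (-(1 / 2) : ℝ) (1 / 2) := by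
  have := Real.pi_pos
  simp only [mem_Icc]
  constructor <;> rintro ⟨h1, h2⟩ <;> constructor <;> nlinarith

theorem mem_paleyWiener_pi_iff (f : L2R) : f ∈ paleyWiener Real.pi ↔
    ∀ᵐ w : ℝ, w ∉ Icc (-(1 / 2) : ℝ) (1 / 2) → (𝓕 f : L2R) w = 0 := by
  change (∀ᵐ w : ℝ, 2 * Real.pi * w ∉ Icc (-Real.pi) Real.pi → (𝓕 f : L2R) w = 0) ↔ _
  simp only [two_pi_mul_mem_Icc_iff]

theorem sincShift_mem_paleyWiener (μ : ℝ) : sincShift μ ∈ paleyWiener Real.pi := by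
  rw [mem_paleyWiener_pi_iff, fourier_sincShift]
  filter_upwards [(memLp_bandExp μ 2).coeFn_toLp] with w hw h
  rw [hw, bandExp, indicator_of_notMem h]

theorem inner_sincShift_eq_integral (μ : ℝ) (f : L2R) :
    inner ℂ (sincShift μ) f =
      ∫ w in (-(1 / 2) : ℝ)..(1 / 2),
        Complex.exp ((2 * Real.pi * μ * w : ℝ) * Complex.I) * (𝓕 f : L2R) w := by
  rw [← Lp.inner_fourier_eq, fourier_sincShift, L2.inner_def,
    intervalIntegral.integral_of_le (by norm_num),
    ← integral_Icc_eq_integral_Ioc, ← integral_indicator measurableSet_Icc]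
  refine integral_congr_ae ?_
  filter_upwards [(memLp_bandExp μ 2).coeFn_toLp] with w hw
  rw [hw]
  by_cases h : w ∈ Icc (-(1 / 2) : ℝ) (1 / 2)
  · simp only [bandExp_of_mem μ h, indicator_of_mem h, RCLike.inner_apply, ← Complex.exp_conj,
      map_mul, map_neg, Complex.conj_ofReal, Complex.conj_I, neg_mul_neg]
    exact mul_comm _ _
  · simp only [bandExp_of_notMem μ h, indicator_of_notMem h, inner_zero_left]

theorem inner_sincShift_sincShift (s t : ℝ) :
    inner ℂ (sincShift s) (sincShift t) = (nsinc (s - t) : ℂ) := by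
  rw [inner_sincShift_eq_integral, ← integral_exp_eq_nsinc, fourier_sincShift]
  refine intervalIntegral.integral_congr_ae ?_
  filter_upwards [(memLp_bandExp t 2).coeFn_toLp] with w hw h
  rw [uIoc_of_le (by norm_num)] at h
  rw [hw, bandExp, indicator_of_mem (Ioc_subset_Icc_self h), ← Complex.exp_add]
  congr 1
  push_cast
  ring

/-- The Fourier transform is an isometry, and `L²` convergence gives an a.e. convergent subsequence,
which preserves vanishing off the band. -/
theorem isClosed_paleyWiener_pi : IsClosed (paleyWiener Real.pi : Set L2R) := by
  refine isClosed_of_closure_subset fun f hf => ?_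
  obtain ⟨u, hu, hlim⟩ := mem_closure_iff_seq_limit.1 hf
  have hF : Tendsto (fun n => (𝓕 (u n) : L2R)) atTop (𝓝 (𝓕 f)) :=
    ((Lp.fourierTransformₗᵢ ℝ ℂ).continuous.tendsto f).comp hlim
  obtain ⟨φ, -, hφ⟩ := (tendstoInMeasure_of_tendsto_Lp hF).exists_seq_tendsto_ae
  rw [SetLike.mem_coe, mem_paleyWiener_pi_iff]
  have hz : ∀ᵐ w : ℝ, ∀ n, w ∉ Icc (-(1 / 2) : ℝ) (1 / 2) → (𝓕 (u n) : L2R) w = 0 :=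
    ae_all_iff.2 fun n => (mem_paleyWiener_pi_iff _).1 (hu n)
  filter_upwards [hφ, hz] with w h1 h2 hw
  refine tendsto_nhds_unique h1 ?_
  simp only [h2 _ hw]
  exact tendsto_const_nhds

instance : CompleteSpace (paleyWiener Real.pi) :=
  isClosed_paleyWiener_pi.completeSpace_coe

/-- The transform is square integrable and lives on a bounded band, hence is integrable, so Fourier
inversion holds a.e.; continuity of both sides upgrades this to every point. -/
theorem inner_sincShift_eq_apply {f : ℝ → ℂ} (hf : MemLp f 2 volume) (hc : Continuous f)
    (hpw : hf.toLp f ∈ paleyWiener Real.pi) (t : ℝ) :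
    inner ℂ (sincShift t) (hf.toLp f) = f t := by
  set F : L2R := 𝓕 (hf.toLp f) with hF
  have hsupp := (mem_paleyWiener_pi_iff _).1 hpw
  have hFind : (Icc (-(1 / 2) : ℝ) (1 / 2)).indicator F =ᵐ[volume] F := by
    filter_upwards [hsupp] with w hw
    by_cases h : w ∈ Icc (-(1 / 2) : ℝ) (1 / 2)
    · rw [indicator_of_mem h]
    · rw [indicator_of_notMem h, hw h]
  have hFi : Integrable F := by
    refine Integrable.congr ?_ hFind
    rw [integrable_indicator_iff measurableSet_Icc]
    exact ((Lp.memLp F).restrict _).integrable (by norm_num)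
  have hinv : (𝓕⁻ F : L2R) = hf.toLp f := FourierTransform.fourierInv_fourier_eq _
  have h1 := fourierInv_toLp_ae_eq (Lp.memLp F) hFi
  rw [Lp.toLp_coeFn, hinv] at h1
  have hcont : Continuous (𝓕⁻ (F : ℝ → ℂ)) :=
    VectorFourier.fourierIntegral_continuous Real.continuous_fourierChar
      (by exact (continuous_inner (𝕜 := ℝ) (E := ℝ)).neg) hFi
  have h2 : f = 𝓕⁻ (F : ℝ → ℂ) :=
    (hc.ae_eq_iff_eq volume hcont).1 (hf.coeFn_toLp.symm.trans h1)
  rw [inner_sincShift_eq_integral, congrFun h2 t, Real.fourierInv_eq',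
    intervalIntegral.integral_of_le (by norm_num),
    ← integral_Icc_eq_integral_Ioc, ← integral_indicator measurableSet_Icc]
  refine integral_congr_ae ?_
  filter_upwards [hsupp] with w hw
  by_cases h : w ∈ Icc (-(1 / 2) : ℝ) (1 / 2)
  · rw [indicator_of_mem h, smul_eq_mul]
    congr 2
    simp
    ring
  · rw [indicator_of_notMem h, hw h, smul_zero]

/-- The pairings are the Fourier coefficients, on the band, of the transform multiplied by a
unimodular character; Parseval finishes. -/
theorem eq_zero_of_inner_sincShift_int_add_eq_zero {f : L2R} (hf : f ∈ paleyWiener Real.pi) (s : ℝ)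
    (h : ∀ n : ℤ, inner ℂ (sincShift (n + s)) f = 0) : f = 0 := by
  set F : L2R := 𝓕 f with hF
  set g : ℝ → ℂ := fun w => Complex.exp ((2 * Real.pi * s * w : ℝ) * Complex.I) * F w with hg
  have hnorm : ∀ w, ‖g w‖ = ‖F w‖ := fun w => by
    rw [hg]; simp only [norm_mul, Complex.norm_exp_ofReal_mul_I, one_mul]
  have hgm : AEStronglyMeasurable g volume :=
    (Continuous.aestronglyMeasurable (by fun_prop)).mul (Lp.aestronglyMeasurable F)
  have hg2 : MemLp g 2 volume :=
    (Lp.memLp F).mono hgm (Eventually.of_forall fun w => (hnorm w).le)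
  have hab : (-(1 / 2) : ℝ) < 1 / 2 := by norm_num
  have hcoef : ∀ n : ℤ, fourierCoeffOn hab g n = 0 := fun n => by
    rw [fourierCoeffOn_eq_integral]
    -- The index is negated because Fourier coefficients pair with `exp (-2πinw)`.
    have h' := h (-n)
    rw [inner_sincShift_eq_integral] at h'
    rw [smul_eq_zero]
    right
    rw [← h']
    refine intervalIntegral.integral_congr fun w _ => ?_
    simp only [fourier_coe_apply, hg, smul_eq_mul]
    rw [← mul_assoc, ← Complex.exp_add]
    congr 2
    push_cast
    ring
  have hs := hasSum_sq_fourierCoeffOn hab (hg2.restrict _)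
  simp only [hcoef, norm_zero, ne_eq, OfNat.ofNat_ne_zero, not_false_eq_true, zero_pow] at hs
  have h0 := hs.unique hasSum_zero
  have h0' : ∫ w in Ioc (-(1 / 2) : ℝ) (1 / 2), ‖F w‖ ^ 2 = 0 := by
    rw [← intervalIntegral.integral_of_le hab.le]
    simp only [hnorm] at h0
    norm_num at h0 ⊢
    exact h0
  have hint : IntegrableOn (fun w => ‖F w‖ ^ 2) (Ioc (-(1 / 2) : ℝ) (1 / 2)) :=
    ((memLp_two_iff_integrable_sq_norm (Lp.aestronglyMeasurable F)).1 (Lp.memLp F)).integrableOn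
  have hz := (setIntegral_eq_zero_iff_of_nonneg_ae
    (Eventually.of_forall fun w => by positivity) hint).1 h0'
  have hz' := (ae_restrict_iff' measurableSet_Ioc).1 hz
  -- Parseval covers the half-open interval; the left endpoint of the band is a null set.
  have hne : ∀ᵐ w : ℝ, w ≠ -(1 / 2) := by simp [ae_iff]
  have hF0 : F = 0 := by
    rw [Lp.eq_zero_iff_ae_eq_zero]
    filter_upwards [hz', hne, (mem_paleyWiener_pi_iff f).1 hf] with w h1 h2 h3
    by_cases hw : w ∈ Icc (-(1 / 2) : ℝ) (1 / 2)
    · simpa using h1 ⟨lt_of_le_of_ne hw.1 h2.symm, hw.2⟩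
    · exact h3 hw
  have : ‖f‖ = 0 := by rw [← Lp.norm_fourier_eq, ← hF, hF0, norm_zero]
  exact norm_eq_zero.1 this

theorem nsinc_intCast (n : ℤ) : nsinc n = if n = 0 then 1 else 0 := by
  split_ifs with h
  · simp [h, nsinc_zero]
  · rw [nsinc_of_ne_zero (by exact_mod_cast h), mul_comm Real.pi, Real.sin_int_mul_pi, zero_div]

/-- `sincShift μ` as an element of the Paley-Wiener space. -/
def pwSinc (μ : ℝ) : paleyWiener Real.pi := ⟨sincShift μ, sincShift_mem_paleyWiener μ⟩

theorem inner_pwSinc_pwSinc (s t : ℝ) : inner ℂ (pwSinc s) (pwSinc t) = (nsinc (s - t) : ℂ) :=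
  inner_sincShift_sincShift s t

theorem orthonormal_pwSinc (s : ℝ) : Orthonormal ℂ fun n : ℤ => pwSinc (n + s) := by
  rw [orthonormal_iff_ite]
  intro i j
  rw [inner_pwSinc_pwSinc, show ((i : ℝ) + s - (j + s)) = ((i - j : ℤ) : ℝ) by push_cast; ring,
    nsinc_intCast]
  simp only [sub_eq_zero]
  split_ifs <;> simp

theorem span_pwSinc_orthogonal (s : ℝ) :
    (Submodule.span ℂ (range fun n : ℤ => pwSinc (n + s)))ᗮ = ⊥ := by
  rw [Submodule.eq_bot_iff]
  intro f hf
  refine Subtype.ext (eq_zero_of_inner_sincShift_int_add_eq_zero f.2 s fun n => ?_)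
  exact (Submodule.mem_orthogonal _ _).1 hf _ (Submodule.subset_span ⟨n, rfl⟩)

/-- The orthonormal basis `(sinc (· - n - s))ₙ` of the Paley-Wiener space. -/
def sincBasis (s : ℝ) : HilbertBasis ℤ ℂ (paleyWiener Real.pi) :=
  HilbertBasis.mkOfOrthogonalEqBot (orthonormal_pwSinc s) (span_pwSinc_orthogonal s)

theorem sincBasis_apply (s : ℝ) (n : ℤ) : sincBasis s n = pwSinc (n + s) := by
  rw [sincBasis, HilbertBasis.coe_mkOfOrthogonalEqBot]

/-- Expansion along the shifted sinc basis. -/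
theorem hasSum_inner_smul_pwSinc (s : ℝ) (f : paleyWiener Real.pi) :
    HasSum (fun n : ℤ => inner ℂ (pwSinc (n + s)) f • pwSinc (n + s)) f := by
  have h := (sincBasis s).hasSum_repr f
  simpa only [HilbertBasis.repr_apply_apply, sincBasis_apply] using h

/-! ### Perturbation of an orthonormal basis -/

section PaleyWienerPerturbation

variable {ι κ K : Type*} [NormedAddCommGroup K] [InnerProductSpace ℂ K]

/-- In coordinates the operator is diagonal multiplication by `α`, bounded by `M`, followed by the
isometry attached to `v`. -/
theorem HilbertBasis.exists_clm_apply_eq_smul [CompleteSpace K] (b : HilbertBasis ι ℂ K) {v : ι → K}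
    (hv : Orthonormal ℂ v) (α : ι → ℂ) {M : ℝ} (hM : 0 ≤ M) (hα : ∀ n, ‖α n‖ ≤ M) :
    ∃ A : K →L[ℂ] K, ‖A‖ ≤ M ∧ ∀ n, A (b n) = α n • v n := by
  classical
  have hle : ∀ (c : lp (fun _ : ι => ℂ) 2) (i : ι), ‖α i * c i‖ ≤ ‖((M : ℂ) • c) i‖ := fun c i => by
    rw [lp.coeFn_smul, Pi.smul_apply, norm_smul, norm_mul, Complex.norm_real,
      Real.norm_of_nonneg hM]
    exact mul_le_mul_of_nonneg_right (hα i) (norm_nonneg _)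
  have hmem : ∀ c : lp (fun _ : ι => ℂ) 2, Memℓp (fun i => α i * c i) 2 := fun c =>
    (lp.memℓp ((M : ℂ) • c)).mono' (hle c)
  let D : lp (fun _ : ι => ℂ) 2 →L[ℂ] lp (fun _ : ι => ℂ) 2 :=
    LinearMap.mkContinuous
      { toFun := fun c => ⟨fun i => α i * c i, hmem c⟩
        map_add' := fun c d => by ext i; exact mul_add _ _ _
        map_smul' := fun a c => by ext i; simp [mul_left_comm] } M fun c => by
      refine (lp.norm_mono (x := ⟨fun i => α i * c i, hmem c⟩) (y := (M : ℂ) • c) two_ne_zero (hle c)).trans ?_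
      rw [lp.norm_const_smul two_ne_zero, Complex.norm_real, Real.norm_of_nonneg hM]
  refine ⟨hv.orthogonalFamily.linearIsometry.toContinuousLinearMap ∘L D ∘L
    b.repr.toContinuousLinearEquiv.toContinuousLinearMap, ?_, fun n => ?_⟩
  · refine ContinuousLinearMap.opNorm_le_bound _ hM fun x => ?_
    have h1 : ‖D (b.repr x)‖ ≤ M * ‖b.repr x‖ := (LinearMap.mkContinuous_norm_le _ hM _ |>
      D.le_of_opNorm_le) _
    simpa using h1
  · have h1 : D (b.repr (b n)) = lp.single 2 n (α n) := by
      rw [b.repr_self]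
      ext i
      simp only [D, LinearMap.mkContinuous_apply, LinearMap.coe_mk, AddHom.coe_mk, lp.single_apply]
      by_cases h : i = n
      · subst h; simp
      · simp [h]
    change hv.orthogonalFamily.linearIsometry (D (b.repr (b n))) = _
    rw [h1, OrthogonalFamily.linearIsometry_apply_single]
    rfl

/-- If `b n - x n = ∑ⱼ α j n • v j n` with orthonormal systems `v j` and
`∑ⱼ supₙ ‖α j n‖ < 1`, then `x` is the image of the basis `b` under an invertible operator. -/
theorem HilbertBasis.exists_unit_apply_eq [CompleteSpace K] (b : HilbertBasis ι ℂ K) (x : ι → K)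
    {v : κ → ι → K} (hv : ∀ j, Orthonormal ℂ (v j)) {α : κ → ι → ℂ} {M : κ → ℝ} {q : ℝ}
    (hα : ∀ j n, ‖α j n‖ ≤ M j) (hM0 : ∀ j, 0 ≤ M j) (hM : HasSum M q) (hq : q < 1)
    (hx : ∀ n, HasSum (fun j => α j n • v j n) (b n - x n)) :
    ∃ T : (K →L[ℂ] K)ˣ, ∀ n, T.val (b n) = x n := by
  choose A hA hAb using fun j => b.exists_clm_apply_eq_smul (hv j) (α j) (hM0 j) (hα j)
  have hs : Summable A := Summable.of_norm_bounded hM.summable hA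
  -- The norm is at most `q < 1`, so `1 - ∑ A j` is inverted by a Neumann series.
  have hn : ‖∑' j, A j‖ < 1 := (tsum_of_norm_bounded hM hA).trans_lt hq
  refine ⟨Units.oneSub _ hn, fun n => ?_⟩
  have h1 : HasSum (fun j => A j (b n)) ((∑' j, A j) (b n)) :=
    hs.hasSum.mapL (ContinuousLinearMap.apply ℂ K (b n))
  simp only [hAb] at h1
  rw [Units.val_oneSub, sub_apply, h1.unique (hx n)]
  simp

variable (b : HilbertBasis ι ℂ K) (T : (K →L[ℂ] K)ˣ)

theorem HilbertBasis.hasSum_inner_inv_smul (f : K) :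
    HasSum (fun n => inner ℂ (b n) (T⁻¹.val f) • T.val (b n)) f := by
  have h := (b.hasSum_repr (T⁻¹.val f)).mapL T.val
  have h1 : T.val (T⁻¹.val f) = f := by
    rw [← mul_apply_eq_comp, T.mul_inv, one_apply_eq_self]
  rw [h1] at h
  simpa only [map_smul, HilbertBasis.repr_apply_apply] using h

theorem HilbertBasis.inner_adjoint_inv [CompleteSpace K] (n : ι) (f : K) :
    inner ℂ (ContinuousLinearMap.adjoint T⁻¹.val (b n)) f = inner ℂ (b n) (T⁻¹.val f) :=
  ContinuousLinearMap.adjoint_inner_left _ _ _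

/-- Pairing `x' n` with the expansion of `f` along `T (b k)` leaves only the coefficient `⟪b n, T⁻¹
f⟫`, for every `f`. -/
theorem HilbertBasis.eq_adjoint_inv_of_biorthogonal [CompleteSpace K] [DecidableEq ι] {x' : ι → K}
    (h : ∀ k n, inner ℂ (x' n) (T.val (b k)) = if k = n then (1 : ℂ) else 0) (n : ι) :
    x' n = ContinuousLinearMap.adjoint T⁻¹.val (b n) := by
  refine ext_inner_right ℂ fun f => ?_
  rw [b.inner_adjoint_inv]
  have h1 := (b.hasSum_inner_inv_smul T f).mapL (innerSL ℂ (x' n))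
  simp only [map_smul, innerSL_apply_apply, h, smul_eq_mul] at h1
  refine h1.unique ?_
  refine (hasSum_ite_eq n (inner ℂ (b n) (T⁻¹.val f))).congr_fun fun k => ?_
  by_cases hk : k = n <;> simp [hk]

theorem HilbertBasis.inner_adjoint_inv_apply [CompleteSpace K] [DecidableEq ι] (k n : ι) :
    inner ℂ (ContinuousLinearMap.adjoint T⁻¹.val (b n)) (T.val (b k))
      = if k = n then (1 : ℂ) else 0 := by
  rw [b.inner_adjoint_inv, ← mul_apply_eq_comp, T.inv_mul,
    one_apply_eq_self, orthonormal_iff_ite.1 b.orthonormal]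
  simp only [eq_comm]

end PaleyWienerPerturbation

/-! ### Partial fractions of cotangent and tangent -/

section CotangentSeries

theorem hasSum_cot_series {x : ℝ} (h0 : 0 < x) (h1 : x < 1) :
    HasSum (fun n : ℕ => x / (((n : ℝ) + 1) ^ 2 - x ^ 2))
      ((1 / x - Real.pi * (Real.cos (Real.pi * x) / Real.sin (Real.pi * x))) / 2) := by
  have hx : (x : ℂ) ∈ Complex.integerComplement := by
    rintro ⟨n, hn⟩
    have hn' : (n : ℝ) = x := by exact_mod_cast hn
    rw [← hn'] at h0 h1
    have h2 : (0 : ℤ) < n := by exact_mod_cast h0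
    have h3 : n < (1 : ℤ) := by exact_mod_cast h1
    omega
  have hs := (summable_cotTerm hx).hasSum
  have ht : ∑' n, cotTerm (x : ℂ) n = _ := (cot_series_rep' hx).symm
  rw [ht, ← Complex.ofReal_mul, ← Complex.ofReal_cot] at hs
  have hr : HasSum (fun n : ℕ => 1 / (x - (n + 1)) + 1 / (x + (n + 1)))
      (Real.pi * Real.cot (Real.pi * x) - 1 / x) := by
    rw [← Complex.hasSum_ofReal]
    push_cast
    push_cast at hs
    exact hs
  have h := hr.mul_left (-(1 / 2))
  rw [Real.cot_eq_cos_div_sin] at h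
  have hv : (1 / x - Real.pi * (Real.cos (Real.pi * x) / Real.sin (Real.pi * x))) / 2 =
      -(1 / 2) * (Real.pi * (Real.cos (Real.pi * x) / Real.sin (Real.pi * x)) - 1 / x) := by ring
  rw [hv]
  refine h.congr_fun fun n => ?_
  have hn : (0 : ℝ) ≤ n := n.cast_nonneg
  have e1 : x - (n + 1) ≠ 0 := by linarith
  have e2 : x + (n + 1) ≠ 0 := by positivity
  have e3 : ((n : ℝ) + 1) ^ 2 - x ^ 2 ≠ 0 := by nlinarith
  field_simp
  ring

/-- The cotangent series at `2x` splits by parity of the index: the even terms are half the wanted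
ones, the odd terms half the cotangent series at `x`. The double-angle formulas evaluate the
difference. -/
theorem hasSum_tan_series {x : ℝ} (h0 : 0 < x) (h1 : x < 1 / 2) :
    HasSum (fun n : ℕ => x / (((n : ℝ) + 1 / 2) ^ 2 - x ^ 2))
      (Real.pi / 2 * (Real.sin (Real.pi * x) / Real.cos (Real.pi * x))) := by
  set f : ℕ → ℝ := fun n => 2 * x / (((n : ℝ) + 1) ^ 2 - (2 * x) ^ 2) with hf
  have h2 : HasSum f _ := hasSum_cot_series (x := 2 * x) (by linarith) (by linarith)
  have heven : ∀ n : ℕ, x / (((n : ℝ) + 1 / 2) ^ 2 - x ^ 2) = 2 * f (2 * n) := fun n => by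
    have hn : (0 : ℝ) ≤ n := n.cast_nonneg
    have e1 : ((n : ℝ) + 1 / 2) ^ 2 - x ^ 2 ≠ 0 := by nlinarith
    have e2 : ((2 * n : ℝ) + 1) ^ 2 - (2 * x) ^ 2 ≠ 0 := by nlinarith
    simp only [hf]
    push_cast
    rw [← mul_div_assoc, div_eq_div_iff e1 e2]
    ring
  have hodd : ∀ n : ℕ, f (2 * n + 1) = 1 / 2 * (x / (((n : ℝ) + 1) ^ 2 - x ^ 2)) := fun n => by
    have hn : (0 : ℝ) ≤ n := n.cast_nonneg
    have e1 : ((n : ℝ) + 1) ^ 2 - x ^ 2 ≠ 0 := by nlinarith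
    have e2 : ((2 * n + 1 : ℝ) + 1) ^ 2 - (2 * x) ^ 2 ≠ 0 := by nlinarith
    simp only [hf]
    push_cast
    rw [← mul_div_assoc, div_eq_div_iff e2 e1]
    ring
  have ho : HasSum (fun n => f (2 * n + 1)) _ :=
    ((hasSum_cot_series h0 (by linarith)).mul_left (1 / 2)).congr_fun hodd
  have hes : Summable fun n => f (2 * n) :=
    h2.summable.comp_injective (i := fun n : ℕ => 2 * n) fun a b h => by simpa using h
  have htot := h2.unique (hes.hasSum.even_add_odd ho)
  have he := (hes.hasSum.mul_left 2).congr_fun heven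
  have hp := Real.pi_pos
  have hs : Real.sin (Real.pi * x) ≠ 0 :=
    (Real.sin_pos_of_pos_of_lt_pi (by positivity) (by nlinarith)).ne'
  have hc : Real.cos (Real.pi * x) ≠ 0 :=
    (Real.cos_pos_of_mem_Ioo ⟨by nlinarith, by nlinarith⟩).ne'
  have hsc := Real.sin_sq_add_cos_sq (Real.pi * x)
  rw [show Real.pi * (2 * x) = 2 * (Real.pi * x) by ring, Real.cos_two_mul, Real.sin_two_mul] at htot
  have hval : ∑' n, f (2 * n) = (1 / (2 * x) - Real.pi * ((2 * Real.cos (Real.pi * x) ^ 2 - 1) /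
      (2 * Real.sin (Real.pi * x) * Real.cos (Real.pi * x)))) / 2 - 1 / 2 * ((1 / x - Real.pi *
      (Real.cos (Real.pi * x) / Real.sin (Real.pi * x))) / 2) := by linarith
  have hfin : Real.pi / 2 * (Real.sin (Real.pi * x) / Real.cos (Real.pi * x)) =
      2 * ∑' n, f (2 * n) := by
    rw [hval]
    generalize Real.sin (Real.pi * x) = s at *
    generalize Real.cos (Real.pi * x) = c at *
    field_simp
    linear_combination Real.pi * x * hsc
  rw [hfin]
  exact he

end CotangentSeries

/-! ### Size and sum of Kadec's coefficients -/

theorem sin_lt_cos_of_lt_pi_div_four {x : ℝ} (h0 : 0 ≤ x) (h1 : x < Real.pi / 4) :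
    Real.sin x < Real.cos x := by
  rw [← Real.sin_pi_div_two_sub]
  exact Real.sin_lt_sin_of_lt_of_le_pi_div_two (by linarith) (by linarith) (by linarith)

/-- The derivative `cos x - x sin x` is positive inside, since `sin x < cos x` and `x < π/4 < 1`. -/
theorem monotoneOn_mul_cos : MonotoneOn (fun x : ℝ => x * Real.cos x) (Icc 0 (Real.pi / 4)) := by
  refine monotoneOn_of_deriv_nonneg (convex_Icc _ _) (by fun_prop) (by fun_prop) fun x hx => ?_
  rw [interior_Icc] at hx
  have hd : HasDerivAt (fun x : ℝ => x * Real.cos x) (1 * Real.cos x + x * -Real.sin x) x :=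
    (hasDerivAt_id x).mul (Real.hasDerivAt_cos x)
  rw [hd.deriv]
  have h1 := sin_lt_cos_of_lt_pi_div_four hx.1.le hx.2
  have h2 : 0 < Real.sin x :=
    Real.sin_pos_of_pos_of_lt_pi hx.1 (by linarith [hx.2, Real.pi_pos])
  nlinarith [hx.2, Real.pi_lt_four]

theorem nsinc_neg (x : ℝ) : nsinc (-x) = nsinc x := by
  rw [nsinc, nsinc, mul_neg, Real.sinc_neg]

/-- `nsinc x` is the slope of the chord of the concave sine from `0` to `πx`. -/
theorem antitoneOn_nsinc : AntitoneOn nsinc (Icc 0 1) := by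
  intro x hx y hy hxy
  have hp := Real.pi_pos
  rcases hx.1.eq_or_lt with h0 | h0
  · rw [← h0, nsinc_zero]
    exact Real.sinc_le_one _
  have h := strictConcaveOn_sin_Icc.concaveOn.antitoneOn_slope_gt (x := 0) ⟨le_rfl, hp.le⟩
    (a := Real.pi * x) (b := Real.pi * y)
    ⟨⟨by positivity, by nlinarith [hx.2]⟩, by positivity⟩
    ⟨⟨by nlinarith [hy.1], by nlinarith [hy.2]⟩, by nlinarith⟩ (by nlinarith)
  rw [nsinc_of_ne_zero h0.ne', nsinc_of_ne_zero (h0.trans_le hxy).ne']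
  simpa [slope_def_field] using h


/-- The coefficients of `1 - cos (δ x)` along `exp (i k x)`. -/
def cosCoef (δ : ℝ) (k : ℤ) : ℝ := nsinc k - (nsinc (k - δ) + nsinc (k + δ)) / 2

/-- The coefficients of `-i sin (δ x)` along `exp (i (k + 1/2) x)`, up to sign. -/
def sinCoef (δ : ℝ) (k : ℤ) : ℝ := (nsinc (k + 1 / 2 + δ) - nsinc (k + 1 / 2 - δ)) / 2

/-- The supremum of `|cosCoef δ k|` over `|δ| ≤ L`. -/
def cosMaj (L : ℝ) (k : ℤ) : ℝ :=
  if k = 0 then 1 - nsinc L else L * Real.sin (Real.pi * L) / (Real.pi * ((k : ℝ) ^ 2 - L ^ 2))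

/-- The supremum of `|sinCoef δ k|` over `|δ| ≤ L`. -/
def sinMaj (L : ℝ) (k : ℤ) : ℝ :=
  L * Real.cos (Real.pi * L) / (Real.pi * (((k : ℝ) + 1 / 2) ^ 2 - L ^ 2))

theorem one_le_intCast_sq {k : ℤ} (hk : k ≠ 0) : (1 : ℝ) ≤ (k : ℝ) ^ 2 := by
  have h : (1 : ℤ) ≤ k ^ 2 := by
    have := sq_pos_of_ne_zero hk
    omega
  exact_mod_cast h

theorem quarter_le_intCast_add_half_sq (k : ℤ) : (1 / 4 : ℝ) ≤ ((k : ℝ) + 1 / 2) ^ 2 := by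
  have h : (0 : ℤ) ≤ k * (k + 1) := by
    rcases le_or_gt 0 k with h | h
    · positivity
    · exact mul_nonneg_of_nonpos_of_nonpos h.le (by omega)
  have h' : (0 : ℝ) ≤ k * (k + 1) := by exact_mod_cast h
  nlinarith

theorem cosCoef_abs (δ : ℝ) (k : ℤ) : cosCoef |δ| k = cosCoef δ k := by
  rcases abs_choice δ with h | h <;> rw [h]
  simp only [cosCoef, sub_neg_eq_add, ← sub_eq_add_neg]
  ring

theorem abs_sinCoef_abs (δ : ℝ) (k : ℤ) : |(sinCoef |δ| k)| = |(sinCoef δ k)| := by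
  rcases abs_choice δ with h | h <;> rw [h]
  rw [← abs_neg]
  simp only [sinCoef, sub_neg_eq_add, ← sub_eq_add_neg]
  congr 1
  ring

theorem abs_cosCoef_of_ne_zero {δ : ℝ} (h0 : 0 ≤ δ) (h1 : δ < 1 / 2) {k : ℤ} (hk : k ≠ 0) :
    |(cosCoef δ k)| = δ * Real.sin (Real.pi * δ) / (Real.pi * ((k : ℝ) ^ 2 - δ ^ 2)) := by
  have hp := Real.pi_pos
  have hk1 := one_le_intCast_sq hk
  have hd : 0 < (k : ℝ) ^ 2 - δ ^ 2 := by nlinarith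
  have hfac : (k : ℝ) ^ 2 - δ ^ 2 = (k - δ) * (k + δ) := by ring
  have hne := hd.ne'
  rw [hfac, mul_ne_zero_iff] at hne
  have hs : 0 ≤ Real.sin (Real.pi * δ) :=
    Real.sin_nonneg_of_nonneg_of_le_pi (by positivity) (by nlinarith)
  have e1 : Real.sin (Real.pi * (k - δ)) = -((-1) ^ k * Real.sin (Real.pi * δ)) := by
    rw [← Real.sin_sub_int_mul_pi, ← Real.sin_neg]
    congr 1
    ring
  have e2 : Real.sin (Real.pi * (k + δ)) = (-1) ^ k * Real.sin (Real.pi * δ) := by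
    rw [← Real.sin_add_int_mul_pi]
    congr 1
    ring
  have key : cosCoef δ k =
      (-1) ^ k * (δ * Real.sin (Real.pi * δ) / (Real.pi * ((k : ℝ) ^ 2 - δ ^ 2))) := by
    rw [cosCoef, nsinc_intCast, if_neg hk, nsinc_of_ne_zero hne.1, nsinc_of_ne_zero hne.2, e1, e2,
      hfac]
    obtain ⟨hn1, hn2⟩ := hne
    field_simp
    ring
  rw [key, abs_mul, abs_neg_one_zpow, one_mul, abs_of_nonneg (by positivity)]

theorem abs_sinCoef_of_nonneg {δ : ℝ} (h0 : 0 ≤ δ) (h1 : δ < 1 / 2) (k : ℤ) :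
    |(sinCoef δ k)| =
      δ * Real.cos (Real.pi * δ) / (Real.pi * (((k : ℝ) + 1 / 2) ^ 2 - δ ^ 2)) := by
  have hp := Real.pi_pos
  have hk1 := quarter_le_intCast_add_half_sq k
  have hd : 0 < ((k : ℝ) + 1 / 2) ^ 2 - δ ^ 2 := by nlinarith
  have hfac : ((k : ℝ) + 1 / 2) ^ 2 - δ ^ 2 = (k + 1 / 2 - δ) * (k + 1 / 2 + δ) := by ring
  have hne := hd.ne'
  rw [hfac, mul_ne_zero_iff] at hne
  have hs : 0 ≤ Real.cos (Real.pi * δ) :=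
    Real.cos_nonneg_of_mem_Icc ⟨by nlinarith, by nlinarith⟩
  have e1 : Real.sin (Real.pi * (k + 1 / 2 - δ)) = (-1) ^ k * Real.cos (Real.pi * δ) := by
    rw [← Real.sin_pi_div_two_sub, ← Real.sin_add_int_mul_pi]
    congr 1
    ring
  have e2 : Real.sin (Real.pi * (k + 1 / 2 + δ)) = (-1) ^ k * Real.cos (Real.pi * δ) := by
    rw [← Real.sin_add_pi_div_two, ← Real.sin_add_int_mul_pi]
    congr 1
    ring
  have key : sinCoef δ k = -((-1) ^ k *
      (δ * Real.cos (Real.pi * δ) / (Real.pi * (((k : ℝ) + 1 / 2) ^ 2 - δ ^ 2)))) := by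
    rw [sinCoef, nsinc_of_ne_zero hne.1, nsinc_of_ne_zero hne.2, e1, e2, hfac]
    obtain ⟨hn1, hn2⟩ := hne
    generalize (k : ℝ) + 1 / 2 = m at *
    field_simp
    ring
  rw [key, abs_neg, abs_mul, abs_neg_one_zpow, one_mul, abs_of_nonneg (by positivity)]

/-- In `|δ|`, the closed form has an increasing numerator and a decreasing positive denominator; at
`k = 0` monotonicity of `nsinc` is used instead. -/
theorem abs_cosCoef_le {δ L : ℝ} (hδ : |δ| ≤ L) (hL : L < 1 / 4) (k : ℤ) :
    |(cosCoef δ k)| ≤ cosMaj L k := by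
  have hp := Real.pi_pos
  have h0 := abs_nonneg δ
  have hL0 := h0.trans hδ
  rw [← cosCoef_abs]
  by_cases hk : k = 0
  · rw [cosMaj, if_pos hk, hk, cosCoef]
    have h1 := antitoneOn_nsinc (a := |δ|) (b := L) ⟨h0, by linarith⟩ ⟨hL0, by linarith⟩ hδ
    have h2 : nsinc |δ| ≤ 1 := Real.sinc_le_one _
    simp only [Int.cast_zero, nsinc_zero, zero_sub, nsinc_neg, zero_add]
    rw [abs_of_nonneg (by linarith)]
    linarith
  · rw [abs_cosCoef_of_ne_zero h0 (by linarith) hk, cosMaj, if_neg hk]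
    have hk1 := one_le_intCast_sq hk
    have hs : Real.sin (Real.pi * |δ|) ≤ Real.sin (Real.pi * L) :=
      Real.sin_le_sin_of_le_of_le_pi_div_two (by nlinarith) (by nlinarith) (by gcongr)
    have hs0 : 0 ≤ Real.sin (Real.pi * |δ|) :=
      Real.sin_nonneg_of_nonneg_of_le_pi (by positivity) (by nlinarith)
    have hd : 0 < (k : ℝ) ^ 2 - L ^ 2 := by nlinarith
    have hLs := mul_nonneg hL0 (hs0.trans hs)
    gcongr

theorem abs_sinCoef_le {δ L : ℝ} (hδ : |δ| ≤ L) (hL : L < 1 / 4) (k : ℤ) :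
    |(sinCoef δ k)| ≤ sinMaj L k := by
  have hp := Real.pi_pos
  have h0 := abs_nonneg δ
  have hL0 := h0.trans hδ
  rw [← abs_sinCoef_abs, abs_sinCoef_of_nonneg h0 (by linarith), sinMaj]
  have hk1 := quarter_le_intCast_add_half_sq k
  have hm := monotoneOn_mul_cos (a := Real.pi * |δ|) (b := Real.pi * L)
    ⟨by positivity, by nlinarith⟩ ⟨by positivity, by nlinarith⟩ (by gcongr)
  have hs : |δ| * Real.cos (Real.pi * |δ|) ≤ L * Real.cos (Real.pi * L) := by
    simp only [mul_assoc] at hm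
    exact le_of_mul_le_mul_left hm hp
  have hd : 0 < ((k : ℝ) + 1 / 2) ^ 2 - L ^ 2 := by nlinarith
  have hc : 0 ≤ L * Real.cos (Real.pi * L) :=
    mul_nonneg hL0 (Real.cos_nonneg_of_mem_Icc ⟨by nlinarith, by nlinarith⟩)
  gcongr

/-- The indices `k` and `-k` contribute equally, and the cotangent series gives `sin πL / (πL) - cos
πL` for all `k ≠ 0`; the term at `k = 0` cancels the quotient. -/
theorem hasSum_cosMaj {L : ℝ} (h0 : 0 < L) (h1 : L < 1) :
    HasSum (cosMaj L) (1 - Real.cos (Real.pi * L)) := by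
  have hp := Real.pi_pos
  have hs : Real.sin (Real.pi * L) ≠ 0 :=
    (Real.sin_pos_of_pos_of_lt_pi (by positivity) (by nlinarith)).ne'
  have h := (hasSum_cot_series h0 h1).mul_left (Real.sin (Real.pi * L) / Real.pi)
  have hpos : HasSum (fun n : ℕ => cosMaj L (n + 1)) _ := h.congr_fun fun n => by
    rw [cosMaj, if_neg (by omega), div_mul_div_comm]
    push_cast
    rw [mul_comm L]
  have hneg : HasSum (fun n : ℕ => cosMaj L (-(n + 1))) _ := h.congr_fun fun n => by
    rw [cosMaj, if_neg (by omega), div_mul_div_comm]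
    push_cast
    rw [mul_comm L, neg_sq]
  have ht := hpos.of_add_one_of_neg_add_one hneg
  convert ht using 1
  rw [cosMaj, if_pos rfl, nsinc_of_ne_zero h0.ne']
  field_simp
  ring

/-- The symmetry is `k ↦ -(k + 1)`, so the sum is twice a tangent series. -/
theorem hasSum_sinMaj {L : ℝ} (h0 : 0 < L) (h1 : L < 1 / 2) :
    HasSum (sinMaj L) (Real.sin (Real.pi * L)) := by
  have hp := Real.pi_pos
  have hc : Real.cos (Real.pi * L) ≠ 0 :=
    (Real.cos_pos_of_mem_Ioo ⟨by nlinarith, by nlinarith⟩).ne'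
  have h := (hasSum_tan_series h0 h1).mul_left (Real.cos (Real.pi * L) / Real.pi)
  have hpos : HasSum (fun n : ℕ => sinMaj L n) _ := h.congr_fun fun n => by
    rw [sinMaj, div_mul_div_comm, mul_comm L]
    push_cast
    rfl
  have hneg : HasSum (fun n : ℕ => sinMaj L (-(n + 1))) _ := h.congr_fun fun n => by
    rw [sinMaj, div_mul_div_comm, mul_comm L]
    push_cast
    congr 3
    ring
  have ht := hpos.of_nat_of_neg_add_one hneg
  convert ht using 1
  field_simp
  ring

/-! ### Kadec's theorem and the sampling expansion -/

theorem inner_pwSinc_smul (s : ℝ) (c : ℂ) (f : paleyWiener Real.pi) :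
    inner ℂ (pwSinc s) (c • f) = c * inner ℂ (pwSinc s) f :=
  inner_smul_right (sincShift s) (f : L2R) c

/-- This is the even part in `δ` of the perturbation. The coefficients do not involve `m`, so they
can be bounded uniformly over the basis index. -/
theorem hasSum_cosCoef_smul (m δ : ℝ) :
    HasSum (fun k : ℤ => (cosCoef δ k : ℂ) • pwSinc (m + k))
      (pwSinc m - (1 / 2 : ℂ) • (pwSinc (m + δ) + pwSinc (m - δ))) := by
  refine (hasSum_inner_smul_pwSinc m _).congr_fun fun k => ?_
  rw [inner_sub_right, inner_pwSinc_smul, inner_add_right, inner_pwSinc_pwSinc, inner_pwSinc_pwSinc,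
    inner_pwSinc_pwSinc, add_comm m, show (k : ℝ) + m - m = k by ring,
    show (k : ℝ) + m - (m + δ) = k - δ by ring, show (k : ℝ) + m - (m - δ) = k + δ by ring, cosCoef]
  congr 1
  push_cast
  ring

theorem hasSum_sinCoef_smul (m δ : ℝ) :
    HasSum (fun k : ℤ => (sinCoef δ k : ℂ) • pwSinc (m + (k + 1 / 2)))
      ((1 / 2 : ℂ) • (pwSinc (m - δ) - pwSinc (m + δ))) := by
  refine (hasSum_inner_smul_pwSinc (m + 1 / 2) _).congr_fun fun k => ?_
  rw [inner_pwSinc_smul, inner_sub_right, inner_pwSinc_pwSinc, inner_pwSinc_pwSinc,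
    show m + ((k : ℝ) + 1 / 2) = k + (m + 1 / 2) by ring,
    show (k : ℝ) + (m + 1 / 2) - (m + δ) = k + 1 / 2 - δ by ring,
    show (k : ℝ) + (m + 1 / 2) - (m - δ) = k + 1 / 2 + δ by ring, sinCoef]
  congr 1
  push_cast
  ring

/-- Kadec's 1/4-theorem: if `|lam n - n| ≤ L < 1/4`, the system `sinc (· - lam n)` is the image of
the orthonormal basis `sinc (· - n)` under an invertible operator of the Paley-Wiener space. -/
theorem exists_unit_apply_sincBasis_eq {L : ℝ} (hL0 : 0 < L) (hL : L < 1 / 4) {lam : ℤ → ℝ}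
    (hlam : ∀ n : ℤ, |lam n - (n : ℝ)| ≤ L) :
    ∃ T : (paleyWiener Real.pi →L[ℂ] paleyWiener Real.pi)ˣ,
      ∀ n, T.val (sincBasis 0 n) = pwSinc (lam n) := by
  have hM : HasSum (Sum.elim (cosMaj L) (sinMaj L))
      (1 - Real.cos (Real.pi * L) + Real.sin (Real.pi * L)) :=
    HasSum.sum (f := Sum.elim (cosMaj L) (sinMaj L)) (hasSum_cosMaj hL0 (by linarith))
      (hasSum_sinMaj hL0 (by linarith))
  have hα : ∀ (j : ℤ ⊕ ℤ) (n : ℤ),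
      ‖(Sum.elim (fun k n => (cosCoef (lam n - n) k : ℂ))
        (fun k n => (sinCoef (lam n - n) k : ℂ)) j n : ℂ)‖ ≤ Sum.elim (cosMaj L) (sinMaj L) j := by
    rintro (k | k) n
    · simpa using abs_cosCoef_le (hlam n) hL k
    · simpa using abs_sinCoef_le (hlam n) hL k
  refine (sincBasis 0).exists_unit_apply_eq (κ := ℤ ⊕ ℤ) (fun n => pwSinc (lam n))
    (v := Sum.elim (fun k n => pwSinc (n + k)) (fun (k : ℤ) (n : ℤ) => pwSinc (n + (k + 1 / 2))))
    ?_ hα (fun j => (norm_nonneg _).trans (hα j 0)) hM ?_ fun n => ?_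
  · rintro (k | k)
    · exact orthonormal_pwSinc _
    · exact orthonormal_pwSinc _
  · have := sin_lt_cos_of_lt_pi_div_four (x := Real.pi * L) (by positivity)
      (by nlinarith [Real.pi_pos])
    linarith
  · have h := HasSum.sum (f := fun j : ℤ ⊕ ℤ => (Sum.elim (fun k n => (cosCoef (lam n - n) k : ℂ))
        (fun k n => (sinCoef (lam n - n) k : ℂ)) j n : ℂ) •
        Sum.elim (fun (k : ℤ) (n : ℤ) => pwSinc (n + k)) (fun (k : ℤ) (n : ℤ) => pwSinc (n + (k + 1 / 2))) j n)
      (hasSum_cosCoef_smul n (lam n - n)) (hasSum_sinCoef_smul n (lam n - n))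
    -- Splitting into the parts even and odd in `δ = lam n - n`.
    have hval : sincBasis 0 n - pwSinc (lam n) =
        (pwSinc n - (1 / 2 : ℂ) • (pwSinc (n + (lam n - n)) + pwSinc (n - (lam n - n)))) +
          (1 / 2 : ℂ) • (pwSinc (n - (lam n - n)) - pwSinc (n + (lam n - n))) := by
      rw [sincBasis_apply, add_zero, add_sub_cancel]
      module
    rw [hval]
    exact h

theorem mainTheorem4 (L : ℝ) (hL : L < 1 / 4) (lam : ℤ → ℝ)
    (hlam : ∀ n : ℤ, |lam n - (n : ℝ)| ≤ L) :
    (∃! x' : ℤ → paleyWiener Real.pi,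
      IsBiorthogonal (fun n => sincShift (lam n)) (fun n => (x' n : L2R))) ∧
    ∀ x' : ℤ → paleyWiener Real.pi,
      IsBiorthogonal (fun n => sincShift (lam n)) (fun n => (x' n : L2R)) →
      ∀ (f : ℝ → ℂ) (hf : MemLp f 2 (volume : Measure ℝ)),
        Continuous f → hf.toLp f ∈ paleyWiener Real.pi →
        (∀ t : ℝ, HasSum
          (fun n : ℤ => inner ℂ (x' n : L2R) (hf.toLp f) * ((nsinc (t - lam n) : ℝ) : ℂ)) (f t)) ∧
        HasSum (fun n : ℤ => inner ℂ (x' n : L2R) (hf.toLp f) • sincShift (lam n))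
          (hf.toLp f) := by
  -- `L` may be `0`, while the series need a positive bound; any number in `(0, 1/4)` can replace
  -- `1/8`.
  obtain ⟨T, hT⟩ := exists_unit_apply_sincBasis_eq (L := max L (1 / 8)) (by positivity)
    (max_lt hL (by norm_num)) fun n => (hlam n).trans (le_max_left _ _)
  have huniq : ∀ x' : ℤ → paleyWiener Real.pi,
      IsBiorthogonal (fun n => sincShift (lam n)) (fun n => (x' n : L2R)) →
      ∀ n, x' n = ContinuousLinearMap.adjoint T⁻¹.val (sincBasis 0 n) := fun x' hx' =>
    (sincBasis 0).eq_adjoint_inv_of_biorthogonal T fun k n => by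
      rw [hT]
      exact hx' k n
  refine ⟨⟨fun n => ContinuousLinearMap.adjoint T⁻¹.val (sincBasis 0 n), fun k n => ?_,
    fun x' hx' => funext (huniq x' hx')⟩, fun x' hx' f hf hc hpw => ?_⟩
  · have h := (sincBasis 0).inner_adjoint_inv_apply T k n
    rw [hT] at h
    exact h
  · have h := (sincBasis 0).hasSum_inner_inv_smul T ⟨hf.toLp f, hpw⟩
    have hsum : HasSum (fun n : ℤ => inner ℂ (x' n : L2R) (hf.toLp f) • sincShift (lam n))
        (hf.toLp f) := by
      refine (h.mapL (paleyWiener Real.pi).subtypeL).congr_fun fun n => ?_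
      rw [map_smul, hT, ← HilbertBasis.inner_adjoint_inv, ← huniq x' hx' n]
      rfl
    refine ⟨fun t => ?_, hsum⟩
    -- Evaluation at `t` is the continuous functional given by the kernel, so `L²` convergence
    -- yields pointwise convergence.
    have ht := hsum.mapL (innerSL ℂ (sincShift t))
    simpa only [map_smul, innerSL_apply_apply, inner_sincShift_sincShift, smul_eq_mul,
      inner_sincShift_eq_apply hf hc hpw] using ht

end
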